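/- For a group $H$, let $b_1(H)$ denote the rank of the free part of the abelianization $H/[H,H]$. For a finitely generated group $G$, let $\Lambda_G$ be the set of subgroups of finite index of $G$, directed by reverse inclusion, and define the Betti volume of $G$ by $$V_b(G)=\limsup_{H\in\Lambda_G}\frac{b_1(H)-1}{[G:H]}=\inf_{H\in\Lambda_G}\ \sup_{K\in\Lambda_G,\,K\le H}\frac{b_1(K)-1}{[G:K]}.$$ Let $(\mathcal G,Y)$ be a graph of groups over a finite connected graph $Y$ (loops and multiple edges allowed), with vertex set $VY\neq\emptyset$ and set $EY$ of geometric (unoriented) edges, with vertex groups $G_u$ ($u\in VY$) and edge groups $G_e$ ($e\in EY$). Assume that every vertex group is finitely generated, that every edge group is finite, and that each vertex group is residually finite or virtually torsion free (that is, has a torsion-free subgroup of finite index). Let $G$ be the fundamental group of $(\mathcal G,Y)$, i.e. $G=\pi_1(\mathcal G,Y,T)$ for a spanning tree $T$ of $Y$. Then $$V_b(G)=\sum_{u\in VY}V_b(G_u)+\sum_{e\in EY}\frac{1}{|G_e|}.$$ -/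

import Mathlib

noncomputable section

/-! ### The Betti volume of a group -/

/-- A group is virtually torsion free if it has a subgroup of finite index whose only element of
finite order is the identity. -/
def IsVirtuallyTorsionFree (G : Type*) [Group G] : Prop :=
  ∃ H : Subgroup G, H.FiniteIndex ∧ ∀ g ∈ H, IsOfFinOrder g → g = 1

/-- The first Betti number of a (finitely generated) group: the rank of the free part of its
abelianization, that is, the maximal number of `ℤ`-linearly independent elements of it. -/
def firstBetti (G : Type*) [Group G] : ℕ :=
  Module.finrank ℤ (Additive (Abelianization G))

/-- The subgroups of finite index of `G`, ordered by inclusion. -/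
abbrev FinIndexSubgroup (G : Type*) [Group G] : Type _ :=
  {H : Subgroup G // H.FiniteIndex}

instance FinIndexSubgroup.instIsDirected (G : Type*) [Group G] :
    IsCodirectedOrder (FinIndexSubgroup G) :=
  ⟨fun H K => ⟨⟨H.1 ⊓ K.1, by have := H.2; have := K.2; infer_instance⟩,
    (inf_le_left : H.1 ⊓ K.1 ≤ H.1), (inf_le_right : H.1 ⊓ K.1 ≤ K.1)⟩⟩

instance FinIndexSubgroup.instNonempty (G : Type*) [Group G] : Nonempty (FinIndexSubgroup G) :=
  ⟨⟨⊤, inferInstance⟩⟩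

/-- The quotient `(b₁(H) - 1) / [G : H]`. -/
def bettiRatio (G : Type*) [Group G] (H : FinIndexSubgroup G) : ℝ :=
  ((firstBetti H.1 : ℝ) - 1) / (H.1.index : ℝ)

/-- The Betti volume of a (finitely generated) group `G`: the upper limit of
`(b₁(H) - 1) / [G : H]` over the net of the subgroups `H` of finite index of `G`, directed by
reverse inclusion. For a finitely generated `G` this net is bounded, see `abs_bettiRatio_le`. -/
def bettiVolume (G : Type*) [Group G] : ℝ :=
  Filter.limsup (bettiRatio G) Filter.atBot

theorem firstBetti_le_rank (G : Type*) [Group G] [Group.FG G] : firstBetti G ≤ Group.rank G := by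
  obtain ⟨S, hS, hcl⟩ := Group.rank_spec G
  rw [← hS]
  have hspan : (⊤ : Submodule ℤ (Additive (Abelianization G))) ≤ Submodule.span ℤ
      (Set.range fun s : S => Additive.ofMul (Abelianization.of (s : G))) := by
    rintro x -
    obtain ⟨g, hg⟩ := QuotientGroup.mk_surjective (s := commutator G) (Additive.toMul x)
    have key : ∀ g ∈ Subgroup.closure (S : Set G), Additive.ofMul (Abelianization.of g) ∈
        Submodule.span ℤ
          (Set.range fun s : S => Additive.ofMul (Abelianization.of (s : G))) := by
      intro g hg
      induction hg using Subgroup.closure_induction with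
      | mem y hy => exact Submodule.subset_span ⟨⟨y, hy⟩, rfl⟩
      | one => simp
      | mul y z _ _ hy hz =>
        rw [map_mul, ofMul_mul]
        exact Submodule.add_mem _ hy hz
      | inv y _ hy =>
        rw [map_inv, ofMul_inv]
        exact Submodule.neg_mem _ hy
    have hx : x = Additive.ofMul (Abelianization.of g) := by
      change x = Additive.ofMul (QuotientGroup.mk g)
      rw [hg]; rfl
    rw [hx]
    exact key g (hcl ▸ Subgroup.mem_top g)
  have h := finrank_le_of_span_eq_top (R := ℤ) (top_le_iff.1 hspan)
  simpa [firstBetti] using h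

/-- The net in the definition of the Betti volume is bounded when `G` is finitely generated. -/
theorem abs_bettiRatio_le (G : Type*) [Group G] [Group.FG G] (H : FinIndexSubgroup G) :
    |bettiRatio G H| ≤ Group.rank G + 1 := by
  have := H.2
  have h0 : (1 : ℝ) ≤ H.1.index := by
    exact_mod_cast Nat.one_le_iff_ne_zero.2 Subgroup.FiniteIndex.index_ne_zero
  have h1 : (firstBetti H.1 : ℝ) ≤ H.1.index * Group.rank G := by
    exact_mod_cast (firstBetti_le_rank H.1).trans (Subgroup.rank_le_index_mul_rank H.1)
  have h2 : (0 : ℝ) ≤ firstBetti H.1 := Nat.cast_nonneg _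
  have h3 : (0 : ℝ) ≤ Group.rank G := Nat.cast_nonneg _
  rw [bettiRatio, abs_div, abs_of_pos (by linarith : (0 : ℝ) < H.1.index),
    div_le_iff₀ (by linarith), abs_le]
  constructor <;> nlinarith

/-! ### Graphs of groups and their fundamental groups -/

universe u v w x

/-- A graph of groups, with vertex set `V` and set of geometric edges `E`. The underlying graph is
a multigraph (loops and multiple edges are allowed) in which an orientation of the edges has been
chosen, so every geometric edge occurs exactly once in `E`. Each edge group is embedded in the
groups of the two endpoints of the edge. -/
structure GraphOfGroups (V : Type u) (E : Type v) where
  /-- The initial vertex of an edge. -/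
  src : E → V
  /-- The terminal vertex of an edge. -/
  tgt : E → V
  /-- The vertex groups. -/
  vertexGroup : V → Type w
  [instVertexGroup : ∀ u, Group (vertexGroup u)]
  /-- The edge groups. -/
  edgeGroup : E → Type x
  [instEdgeGroup : ∀ e, Group (edgeGroup e)]
  /-- The monomorphism from an edge group to the group of the initial vertex. -/
  toSrc : ∀ e, edgeGroup e →* vertexGroup (src e)
  /-- The monomorphism from an edge group to the group of the terminal vertex. -/
  toTgt : ∀ e, edgeGroup e →* vertexGroup (tgt e)
  toSrc_injective : ∀ e, Function.Injective (toSrc e)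
  toTgt_injective : ∀ e, Function.Injective (toTgt e)

namespace GraphOfGroups

attribute [instance] GraphOfGroups.instVertexGroup GraphOfGroups.instEdgeGroup

variable {V : Type u} {E : Type v} (𝒢 : GraphOfGroups.{u, v, w, x} V E)

/-- The unordered pair of endpoints of an edge. -/
def ends (e : E) : Sym2 V := s(𝒢.src e, 𝒢.tgt e)

/-- A set `T` of edges is (the set of edges of) a spanning tree of the underlying graph if it has
no loops, no two edges with the same endpoints, and the simple graph which it then forms on
all the vertices is a tree. A graph has a spanning tree if and only if it is nonempty and
connected. -/
structure IsSpanningTree (T : Set E) : Prop where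
  not_loop : ∀ e ∈ T, ¬ (𝒢.ends e).IsDiag
  injOn_ends : Set.InjOn 𝒢.ends T
  isTree : (SimpleGraph.fromEdgeSet (𝒢.ends '' T)).IsTree

/-- The free product of all the vertex groups and of the free group on the edges. -/
abbrev PreGroup : Type (max u v w) :=
  Monoid.Coprod (Monoid.CoprodI 𝒢.vertexGroup) (FreeGroup E)

/-- The image of an element of a vertex group in the free product. -/
def preOf (u : V) : 𝒢.vertexGroup u →* 𝒢.PreGroup :=
  Monoid.Coprod.inl.comp Monoid.CoprodI.of

/-- The stable letter of an edge in the free product. -/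
def preT (e : E) : 𝒢.PreGroup := Monoid.Coprod.inr (FreeGroup.of e)

/-- The relators of the fundamental group with respect to `T`: for every edge `e` and every `a`
in its edge group the relation `t_e * a_tgt * t_e⁻¹ = a_src` between the stable letter and the
two images of `a`, and the relation `t_e = 1` for every edge `e` in `T`. -/
def relators (T : Set E) : Set 𝒢.PreGroup :=
  {r | ∃ (e : E) (a : 𝒢.edgeGroup e),
      r = 𝒢.preT e * 𝒢.preOf (𝒢.tgt e) (𝒢.toTgt e a) * (𝒢.preT e)⁻¹ *
        (𝒢.preOf (𝒢.src e) (𝒢.toSrc e a))⁻¹} ∪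
  {r | ∃ e ∈ T, r = 𝒢.preT e}

/-- The fundamental group of a graph of groups with respect to a spanning tree `T`. -/
abbrev FundamentalGroup (T : Set E) : Type (max u v w) :=
  𝒢.PreGroup ⧸ Subgroup.normalClosure (𝒢.relators T)

end GraphOfGroups

end

/-! The idea is a Mayer–Vietoris count for finite actions. For a group `H` acting on a finite set
`X`, let `Z` be the space of rational functions `f` on `H × X` with `f(gh, x) = f(g, hx) + f(h, x)`.
Splitting `X` into orbits gives `dim Z - |X| = ∑ (b₁(stabilizer) - 1)` over the orbits when `Z` is
finite dimensional; this number is the `excess`. For the action on `G/K` it equals `[G:K]` times the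
Betti ratio of `K`.

For a graph of groups with finite edge groups, a cocycle of `G` amounts to cocycles of the vertex
groups and values on the stable letters, subject to one condition per edge group and one per tree
edge (`ker_obstruction`). These conditions are independent (`obstruction_surjective`), because
finite groups have no rational cohomology in degree one and `T` has no cycles. With `|V| = |T| + 1`
the excess of `G` is the sum over vertices minus the sum over edges. An edge group acting freely has
excess `-|X|/|G_e|`, the source of the terms `1/|G_e|`.

The hypothesis on the vertex groups yields finite quotients injective on the edge groups. Finite
vertex actions that are free on the edge groups, on sets of equal size, glue to an action of `G`
(`exists_rep`). The kernel of such an action forces small vertex stabilizers and gives the upper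
bound. Gluing actions whose stabilizers have nearly maximal Betti ratio gives the lower bound. -/

noncomputable section

universe u v w x

/-! ### Betti numbers as dimensions of spaces of rational homomorphisms -/

open TensorProduct in
theorem finrank_rat_tensorProduct (A : Type*) [AddCommGroup A] :
    Module.finrank ℚ (ℚ ⊗[ℤ] A) = Module.finrank ℤ A :=
  (TensorProduct.isBaseChange ℤ A ℚ).finrank_eq

open Module TensorProduct in
theorem finrank_additive_hom_rat (K : Type*) [Group K] :
    finrank ℚ (Additive K →+ ℚ) = firstBetti K := by
  let A := Additive (Abelianization K)
  let e₁ : (Additive K →+ ℚ) ≃ₗ[ℚ] (A →ₗ[ℤ] ℚ) :=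
    { toFun := fun f =>
        (MonoidHom.toAdditiveLeft
          (Abelianization.lift (AddMonoidHom.toMultiplicativeRight f))).toIntLinearMap
      invFun := fun f => f.toAddMonoidHom.comp (MonoidHom.toAdditive Abelianization.of)
      map_add' := fun f g => by
        refine LinearMap.ext fun x => ?_
        obtain ⟨y, hy⟩ := QuotientGroup.mk_surjective (s := commutator K) (Additive.toMul x)
        obtain rfl : x = Additive.ofMul (Abelianization.of y) := hy.symm
        rfl
      map_smul' := fun c f => by
        refine LinearMap.ext fun x => ?_
        obtain ⟨y, hy⟩ := QuotientGroup.mk_surjective (s := commutator K) (Additive.toMul x)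
        obtain rfl : x = Additive.ofMul (Abelianization.of y) := hy.symm
        rfl
      left_inv := fun f => rfl
      right_inv := fun f => by
        refine LinearMap.ext fun x => ?_
        obtain ⟨y, hy⟩ := QuotientGroup.mk_surjective (s := commutator K) (Additive.toMul x)
        obtain rfl : x = Additive.ofMul (Abelianization.of y) := hy.symm
        rfl }
  let e₂ : (A →ₗ[ℤ] ℚ) ≃ₗ[ℚ] Dual ℚ (ℚ ⊗[ℤ] A) := LinearMap.liftBaseChangeEquiv ℚ
  rw [(e₁.trans e₂).finrank_eq, Subspace.dual_finrank_eq, finrank_rat_tensorProduct]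
  rfl

/-! ### Cocycles of a permutation action -/

/-- The rational cocycles of the groupoid of an action `ρ` of `H` on `X`. -/
def actionCocycles {H X : Type*} [Group H] (ρ : H →* Equiv.Perm X) : Submodule ℚ (H → X → ℚ) where
  carrier := {f | ∀ g h x, f (g * h) x = f g (ρ h x) + f h x}
  add_mem' := by
    intro a b ha hb g h x
    simp only [Pi.add_apply, ha g h x, hb g h x]
    ring
  zero_mem' := by simp
  smul_mem' := by
    intro c a ha g h x
    simp only [Pi.smul_apply, ha g h x, smul_add]

namespace actionCocycles

variable {H X : Type*} [Group H] {ρ : H →* Equiv.Perm X}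

theorem cocycle_mul (f : actionCocycles ρ) (g h : H) (x : X) :
    f.1 (g * h) x = f.1 g (ρ h x) + f.1 h x := f.2 g h x

theorem cocycle_one (f : actionCocycles ρ) (x : X) : f.1 1 x = 0 := by
  have := cocycle_mul f 1 1 x
  simpa using this

theorem cocycle_inv (f : actionCocycles ρ) (g : H) (x : X) : f.1 g⁻¹ x = - f.1 g (ρ g⁻¹ x) := by
  have := cocycle_mul f g g⁻¹ x
  rw [mul_inv_cancel, cocycle_one f] at this
  linarith

theorem ext_of_closure {S : Set H} (hS : Subgroup.closure S = ⊤) {f f' : actionCocycles ρ}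
    (h : ∀ s ∈ S, f.1 s = f'.1 s) : f = f' := by
  have key : ∀ g ∈ Subgroup.closure S, f.1 g = f'.1 g := by
    intro g hg
    induction hg using Subgroup.closure_induction with
    | mem y hy => exact h y hy
    | one => funext x; rw [cocycle_one f, cocycle_one f']
    | mul y z _ _ hy hz => funext x; rw [cocycle_mul f, cocycle_mul f', hy, hz]
    | inv y _ hy => funext x; rw [cocycle_inv f, cocycle_inv f', hy]
  exact Subtype.ext (funext fun g => key g (hS ▸ Subgroup.mem_top g))

instance finiteDimensional [Finite X] [Group.FG H] : FiniteDimensional ℚ (actionCocycles ρ) := by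
  obtain ⟨S, hS⟩ := (Group.fg_def.1 ‹Group.FG H›)
  let F : actionCocycles ρ →ₗ[ℚ] (S → X → ℚ) :=
    { toFun := fun f s => f.1 s
      map_add' := fun _ _ => rfl
      map_smul' := fun _ _ => rfl }
  refine FiniteDimensional.of_injective F fun f f' h => ext_of_closure hS fun s hs => ?_
  exact congrFun h ⟨s, hs⟩

/-- Restriction of cocycles along a homomorphism. -/
def comap {A : Type*} [Group A] (ι : A →* H) :
    actionCocycles ρ →ₗ[ℚ] actionCocycles (ρ.comp ι) where
  toFun f := ⟨fun a => f.1 (ι a), fun g h x => by simp [cocycle_mul f]⟩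
  map_add' _ _ := rfl
  map_smul' _ _ := rfl

/-- The coboundary of a function. -/
def coboundary (ρ : H →* Equiv.Perm X) : (X → ℚ) →ₗ[ℚ] actionCocycles ρ where
  toFun n := ⟨fun g x => n (ρ g x) - n x, fun g h x => by simp⟩
  map_add' a b := by ext; simp; ring
  map_smul' c a := by ext; simp; ring

@[simp] theorem coboundary_apply (n : X → ℚ) (g : H) (x : X) :
    (coboundary ρ n).1 g x = n (ρ g x) - n x := rfl

/-- Averaging: summing the cocycle rule for `f (g * h) x` over `g` shows that minus the mean of `f`
over the group is a potential. -/
theorem exists_coboundary_eq [Finite H] (f : actionCocycles ρ) : ∃ n, coboundary ρ n = f := by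
  have := Fintype.ofFinite H
  have hc : (Fintype.card H : ℚ) ≠ 0 := by exact_mod_cast Fintype.card_ne_zero
  refine ⟨fun x => - (∑ g, f.1 g x) / Fintype.card H, ?_⟩
  ext h x
  have h1 : ∑ g, f.1 (g * h) x = ∑ g, f.1 g x :=
    Fintype.sum_equiv (Equiv.mulRight h) _ _ fun g => rfl
  simp only [cocycle_mul f, Finset.sum_add_distrib, Finset.sum_const, Finset.card_univ,
    nsmul_eq_mul] at h1
  simp only [coboundary_apply]
  field_simp
  linarith

/-! ### Holonomy around orbit representatives -/

section Orbits

variable [MulAction H X]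

/-- A group element carrying the representative of the orbit of `x` to `x`. -/
def toPoint (H : Type*) {X : Type*} [Group H] [MulAction H X] (x : X) : H :=
  (Quotient.exact (s := MulAction.orbitRel H X)
    (Quotient.out_eq (Quotient.mk (MulAction.orbitRel H X) x)).symm).choose

theorem toPoint_smul (x : X) :
    toPoint H x • (Quotient.mk (MulAction.orbitRel H X) x).out = x :=
  (Quotient.exact (s := MulAction.orbitRel H X)
    (Quotient.out_eq (Quotient.mk (MulAction.orbitRel H X) x)).symm).choose_spec

theorem mk_smul_eq (g : H) (x : X) : Quotient.mk (MulAction.orbitRel H X) (g • x) =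
    Quotient.mk (MulAction.orbitRel H X) x :=
  Quotient.sound (s := MulAction.orbitRel H X) ⟨g, rfl⟩

/-- The element `σ(gx)⁻¹ g σ(x)` of the stabilizer of the representative of an orbit. -/
def returnElt (g : H) (x : X) (ω : MulAction.orbitRel.Quotient H X) (h : Quotient.mk _ x = ω) :
    MulAction.stabilizer H ω.out :=
  ⟨(toPoint H (g • x))⁻¹ * g * toPoint H x, by
    subst h
    rw [MulAction.mem_stabilizer_iff, mul_smul, mul_smul, toPoint_smul, inv_smul_eq_iff]
    conv_rhs => rw [← mk_smul_eq g x]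
    exact (toPoint_smul _).symm⟩

theorem returnElt_mul (g h : H) (x : X) (ω : MulAction.orbitRel.Quotient H X)
    (hx : Quotient.mk _ x = ω) :
    returnElt (g * h) x ω hx =
      returnElt g (h • x) ω ((mk_smul_eq h x).trans hx) * returnElt h x ω hx := by
  refine Subtype.ext ?_
  simp only [returnElt, Subgroup.coe_mul, mul_smul]
  group

theorem toPoint_out_smul (ω : MulAction.orbitRel.Quotient H X) :
    toPoint H ω.out • ω.out = ω.out := by
  have := toPoint_smul (H := H) ω.out
  rwa [Quotient.out_eq] at this

theorem toPoint_smul_out (x : X) (ω : MulAction.orbitRel.Quotient H X)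
    (hx : Quotient.mk _ x = ω) : toPoint H x • ω.out = x := by
  subst hx
  exact toPoint_smul x

theorem returnElt_toPoint (x : X) (ω : MulAction.orbitRel.Quotient H X)
    (hx : Quotient.mk _ x = ω) :
    (returnElt (toPoint H x) ω.out ω ω.out_eq : H) = toPoint H ω.out := by
  simp only [returnElt]
  rw [toPoint_smul_out x ω hx]
  group

/-- The cocycle with given holonomies around the representatives of the orbits. -/
def ofHolonomy (h : ∀ ω : MulAction.orbitRel.Quotient H X,
      Additive (MulAction.stabilizer H ω.out) →+ ℚ) :
    actionCocycles (MulAction.toPermHom H X) :=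
  ⟨fun g x => h (Quotient.mk _ x) (Additive.ofMul (returnElt g x _ rfl)), fun g g' x => by
    have key : ∀ ω (hω : Quotient.mk (MulAction.orbitRel H X) (g' • x) = ω),
        h _ (Additive.ofMul (returnElt g (g' • x) _ rfl)) =
          h ω (Additive.ofMul (returnElt g (g' • x) ω hω)) := by
      rintro ω rfl
      rfl
    beta_reduce
    rw [returnElt_mul, ofMul_mul, map_add]
    exact congrArg₂ _ (key _ (mk_smul_eq g' x)).symm rfl⟩

theorem ofHolonomy_apply (h : ∀ ω : MulAction.orbitRel.Quotient H X,
      Additive (MulAction.stabilizer H ω.out) →+ ℚ) (g : H) (x : X)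
    (ω : MulAction.orbitRel.Quotient H X) (hx : Quotient.mk _ x = ω) :
    (ofHolonomy h).1 g x = h ω (Additive.ofMul (returnElt g x ω hx)) := by
  subst hx
  rfl

variable (H X) in
/-- The holonomies of a cocycle around the representatives of the orbits. -/
def holonomy : actionCocycles (MulAction.toPermHom H X) →ₗ[ℚ]
    ∀ ω : MulAction.orbitRel.Quotient H X, Additive (MulAction.stabilizer H ω.out) →+ ℚ where
  toFun f ω :=
    { toFun := fun k => f.1 (k.toMul : H) ω.out
      map_zero' := cocycle_one f _
      map_add' := fun a b => by
        refine (cocycle_mul f _ _ _).trans ?_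
        rw [MulAction.toPermHom_apply, MulAction.toPerm_apply,
          MulAction.mem_stabilizer_iff.1 b.toMul.2] }
  map_add' _ _ := rfl
  map_smul' _ _ := rfl

theorem holonomy_apply (f : actionCocycles (MulAction.toPermHom H X))
    (ω : MulAction.orbitRel.Quotient H X) (k : MulAction.stabilizer H ω.out) :
    holonomy H X f ω (Additive.ofMul k) = f.1 (k : H) ω.out := rfl

variable (H X) in
/-- A cocycle together with a constant on every orbit amounts to the family of its holonomies
together with a potential. -/
def prodEquiv : (actionCocycles (MulAction.toPermHom H X) ×
      (MulAction.orbitRel.Quotient H X → ℚ)) ≃ₗ[ℚ]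
    (∀ ω : MulAction.orbitRel.Quotient H X, Additive (MulAction.stabilizer H ω.out) →+ ℚ) ×
      (X → ℚ) where
  toFun p := (holonomy H X p.1, fun x =>
    p.1.1 (toPoint H x) (Quotient.mk (MulAction.orbitRel H X) x).out + p.2 (Quotient.mk _ x))
  map_add' p q := by
    refine Prod.ext (map_add _ _ _) (funext fun x => ?_)
    simp only [Prod.fst_add, Prod.snd_add, Pi.add_apply, Submodule.coe_add]
    ring
  map_smul' c p := by
    refine Prod.ext (map_smul _ _ _) (funext fun x => ?_)
    simp [mul_add]
  -- The element `toPoint H ω.out` need not be `1`, only an element of the stabilizer; the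
  -- subtracted term corrects for its holonomy.
  invFun q := (coboundary _ q.2 + ofHolonomy q.1, fun ω => q.2 ω.out -
    (ofHolonomy q.1).1 (toPoint H ω.out) ω.out)
  left_inv p := by
    obtain ⟨f, c⟩ := p
    have h1 : coboundary _ (fun x => f.1 (toPoint H x) (Quotient.mk (MulAction.orbitRel H X) x).out
        + c (Quotient.mk _ x)) + ofHolonomy (holonomy H X f) = f := by
      ext g x
      have e1 := cocycle_mul f (toPoint H (g • x)) ((toPoint H (g • x))⁻¹ * g * toPoint H x)
        (Quotient.mk (MulAction.orbitRel H X) x).out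
      have e2 := cocycle_mul f g (toPoint H x) (Quotient.mk (MulAction.orbitRel H X) x).out
      have e3 := MulAction.mem_stabilizer_iff.1 (returnElt g x _ rfl).2
      simp only [MulAction.toPermHom_apply, MulAction.toPerm_apply] at e1 e2
      rw [toPoint_smul] at e2
      rw [show toPoint H (g • x) * ((toPoint H (g • x))⁻¹ * g * toPoint H x) = g * toPoint H x by
        group, show ((toPoint H (g • x))⁻¹ * g * toPoint H x) •
        (Quotient.mk (MulAction.orbitRel H X) x).out = _ from e3] at e1
      have e4 := mk_smul_eq g x
      simp only [Submodule.coe_add, Pi.add_apply, coboundary_apply, MulAction.toPermHom_apply,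
        MulAction.toPerm_apply]
      rw [ofHolonomy_apply _ _ _ _ rfl, holonomy_apply, e4]
      simp only [returnElt]
      linarith
    refine Prod.ext h1 (funext fun ω => ?_)
    have e1 : (ofHolonomy (holonomy H X f)).1 (toPoint H ω.out) ω.out =
        f.1 (toPoint H ω.out) ω.out := by
      rw [ofHolonomy_apply _ _ _ _ ω.out_eq, holonomy_apply, returnElt_toPoint _ _ ω.out_eq]
    change f.1 (toPoint H ω.out) (Quotient.mk (MulAction.orbitRel H X) ω.out).out +
      c (Quotient.mk _ ω.out) - (ofHolonomy (holonomy H X f)).1 (toPoint H ω.out) ω.out = c ω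
    rw [e1, ω.out_eq]
    ring
  right_inv q := by
    obtain ⟨h, n⟩ := q
    refine Prod.ext (funext fun ω => AddMonoidHom.ext fun k => ?_) (funext fun x => ?_)
    · revert k
      change ∀ k : MulAction.stabilizer H ω.out, _
      intro k
      refine (holonomy_apply _ _ k).trans ?_
      have e0 := MulAction.mem_stabilizer_iff.1 k.2
      -- The return element is a conjugate of `k` within the stabilizer, which a homomorphism to `ℚ`
      -- cannot distinguish from `k`.
      have e1 : returnElt (k : H) ω.out ω ω.out_eq =
          (⟨toPoint H ω.out, toPoint_out_smul ω⟩ : MulAction.stabilizer H ω.out)⁻¹ * k *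
            ⟨toPoint H ω.out, toPoint_out_smul ω⟩ := by
        refine Subtype.ext ?_
        simp only [returnElt, e0, Subgroup.coe_mul, Subgroup.coe_inv]
      simp only [Submodule.coe_add, Pi.add_apply, coboundary_apply, MulAction.toPermHom_apply,
        MulAction.toPerm_apply, e0, sub_self, zero_add]
      rw [ofHolonomy_apply _ _ _ _ ω.out_eq, e1, ofMul_mul, ofMul_mul, ofMul_inv, map_add, map_add,
        map_neg]
      exact neg_add_cancel_comm _ _
    · set ω := Quotient.mk (MulAction.orbitRel H X) x with hω
      have e1 : returnElt (toPoint H x) ω.out ω ω.out_eq =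
          returnElt (toPoint H ω.out) ω.out ω ω.out_eq :=
        Subtype.ext ((returnElt_toPoint x ω rfl).trans (returnElt_toPoint _ ω ω.out_eq).symm)
      simp only [Submodule.coe_add, Pi.add_apply, coboundary_apply, MulAction.toPermHom_apply,
        MulAction.toPerm_apply, ← hω]
      rw [toPoint_smul_out x ω rfl, ofHolonomy_apply _ _ _ _ ω.out_eq,
        ofHolonomy_apply _ _ _ _ ω.out_eq, e1]
      ring

-- Dimension count in `prodEquiv`: the orbit constants on the left are the kernel of the coboundary
-- map.
variable (H X) in
theorem finrank_add_card_orbits [Finite X]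
    [FiniteDimensional ℚ (actionCocycles (MulAction.toPermHom H X))] :
    Module.finrank ℚ (actionCocycles (MulAction.toPermHom H X)) +
        Nat.card (MulAction.orbitRel.Quotient H X) =
      (∑ᶠ ω : MulAction.orbitRel.Quotient H X, firstBetti (MulAction.stabilizer H ω.out)) +
        Nat.card X := by
  classical
  have := Fintype.ofFinite X
  have := Fintype.ofFinite (MulAction.orbitRel.Quotient H X)
  have hfin := Module.Finite.equiv (prodEquiv H X)
  have h1 : Module.Finite ℚ (∀ ω : MulAction.orbitRel.Quotient H X,
      Additive (MulAction.stabilizer H ω.out) →+ ℚ) :=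
    Module.Finite.of_surjective (LinearMap.fst ℚ _ (X → ℚ)) Prod.fst_surjective
  have h2 : ∀ ω : MulAction.orbitRel.Quotient H X,
      Module.Finite ℚ (Additive (MulAction.stabilizer H ω.out) →+ ℚ) := fun ω =>
    Module.Finite.of_surjective (LinearMap.proj (R := ℚ) (φ := fun ω :
      MulAction.orbitRel.Quotient H X => Additive (MulAction.stabilizer H ω.out) →+ ℚ) ω)
      (Function.surjective_eval ω)
  have h := (prodEquiv H X).finrank_eq
  rw [Module.finrank_prod, Module.finrank_prod, Module.finrank_fintype_fun_eq_card,
    Module.finrank_fintype_fun_eq_card, Module.finrank_pi_fintype] at h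
  simp only [finrank_additive_hom_rat] at h
  rw [finsum_eq_sum_of_fintype, Nat.card_eq_fintype_card, Nat.card_eq_fintype_card, h]

end Orbits

end actionCocycles

/-! ### The excess of a finite action -/

theorem firstBetti_congr {H K : Type*} [Group H] [Group K] (e : H ≃* K) :
    firstBetti H = firstBetti K :=
  (MulEquiv.toAdditive e.abelianizationCongr).toIntLinearEquiv.finrank_eq

theorem firstBetti_of_subsingleton (H : Type*) [Group H] [Subsingleton H] : firstBetti H = 0 := by
  have : Subsingleton (Abelianization H) := QuotientGroup.mk_surjective.subsingleton
  have : Subsingleton (Additive (Abelianization H)) := this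
  exact Module.finrank_zero_of_subsingleton

theorem bettiRatio_conj {G : Type*} [Group G] (K K' : FinIndexSubgroup G) (a : G)
    (h : ∀ g, g ∈ K'.1 ↔ a⁻¹ * g * a ∈ K.1) : bettiRatio G K' = bettiRatio G K := by
  have h1 : K'.1 = K.1.map (MulAut.conj a).toMonoidHom := by
    ext g
    rw [h, Subgroup.mem_map_equiv, MulAut.conj_symm_apply]
  have h2 : (K.1.map (MulAut.conj a).toMonoidHom).index = K.1.index :=
    Subgroup.index_map_of_bijective (f := (MulAut.conj a).toMonoidHom) (MulAut.conj a).bijective K.1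
  have h3 : firstBetti (K.1.map (MulAut.conj a).toMonoidHom) = firstBetti K.1 :=
    firstBetti_congr ((MulAut.conj a).subgroupMap K.1).symm
  rw [bettiRatio, bettiRatio, h1, h2, h3]

namespace actionCocycles

variable {H X : Type*} [Group H]

/-- The excess of the dimension of the space of cocycles over the dimension of the space of
functions, that is, `b₁ - b₀` of the action groupoid. -/
def excess (ρ : H →* Equiv.Perm X) : ℝ := Module.finrank ℚ (actionCocycles ρ) - Nat.card X

theorem finiteIndex_stabilizer [Finite X] [MulAction H X] (x : X) :
    (MulAction.stabilizer H x).FiniteIndex := by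
  refine ⟨?_⟩
  rw [MulAction.index_stabilizer]
  exact ((Set.ncard_pos (Set.toFinite _)).2 (MulAction.nonempty_orbit x)).ne'

/-- The stabilizer of a point under a finite permutation representation. -/
def stab [Finite X] (ρ : H →* Equiv.Perm X) (x : X) : FinIndexSubgroup H :=
  letI := MulAction.compHom X ρ
  ⟨MulAction.stabilizer H x, finiteIndex_stabilizer x⟩

theorem mem_stab [Finite X] {ρ : H →* Equiv.Perm X} {x : X} {g : H} :
    g ∈ (stab ρ x).1 ↔ ρ g x = x := Iff.rfl

/-- An orbit contributes `b₁ - 1` of its stabilizer, and the index of that stabilizer is the size of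
the orbit. -/
theorem excess_eq [Finite X] (ρ : H →* Equiv.Perm X) [FiniteDimensional ℚ (actionCocycles ρ)] :
    letI := MulAction.compHom X ρ
    excess ρ = ∑ᶠ ω : MulAction.orbitRel.Quotient H X,
      Nat.card (MulAction.orbit H ω.out) * bettiRatio H (stab ρ ω.out) := by
  let _ := MulAction.compHom X ρ
  have hρ : MulAction.toPermHom H X = ρ := by ext; rfl
  have : FiniteDimensional ℚ (actionCocycles (MulAction.toPermHom H X)) := by rwa [hρ]
  have h := finrank_add_card_orbits H X
  have := Fintype.ofFinite (MulAction.orbitRel.Quotient H X)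
  have h1 : ∀ ω : MulAction.orbitRel.Quotient H X,
      Nat.card (MulAction.orbit H ω.out) * bettiRatio H (stab ρ ω.out) =
        firstBetti (MulAction.stabilizer H ω.out) - 1 := by
    intro ω
    have h2 : (stab ρ ω.out).1.index = Nat.card (MulAction.orbit H ω.out) :=
      MulAction.index_stabilizer _ _
    have h3 : (Nat.card (MulAction.orbit H ω.out) : ℝ) ≠ 0 := by
      rw [← h2]
      exact_mod_cast (stab ρ ω.out).2.index_ne_zero
    rw [bettiRatio, h2, mul_div_cancel₀ _ h3]
    rfl
  rw [finsum_congr h1, finsum_eq_sum_of_fintype, Finset.sum_sub_distrib]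
  rw [finsum_eq_sum_of_fintype, hρ] at h
  have h' : (Module.finrank ℚ (actionCocycles ρ) : ℝ) + Nat.card (MulAction.orbitRel.Quotient H X)
    = (∑ ω : MulAction.orbitRel.Quotient H X, (firstBetti (MulAction.stabilizer H ω.out) : ℝ)) +
      Nat.card X := by exact_mod_cast h
  simp only [Finset.sum_const, Finset.card_univ, nsmul_eq_mul, mul_one, ← Nat.card_eq_fintype_card]
  rw [excess]
  linarith

theorem card_eq_finsum_card_orbit (H X : Type*) [Group H] [Finite X] [MulAction H X] :
    (Nat.card X : ℝ) = ∑ᶠ ω : MulAction.orbitRel.Quotient H X,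
      (Nat.card (MulAction.orbit H ω.out) : ℝ) := by
  have := Fintype.ofFinite (MulAction.orbitRel.Quotient H X)
  rw [finsum_eq_sum_of_fintype, Nat.card_congr (MulAction.selfEquivSigmaOrbits H X), Nat.card_sigma]
  push_cast
  rfl

theorem excess_le [Finite X] (ρ : H →* Equiv.Perm X) [FiniteDimensional ℚ (actionCocycles ρ)]
    (c : ℝ) (h : ∀ x, bettiRatio H (stab ρ x) ≤ c) : excess ρ ≤ Nat.card X * c := by
  let _ := MulAction.compHom X ρ
  have := Fintype.ofFinite (MulAction.orbitRel.Quotient H X)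
  rw [excess_eq, card_eq_finsum_card_orbit H X, finsum_eq_sum_of_fintype, finsum_eq_sum_of_fintype,
    Finset.sum_mul]
  exact Finset.sum_le_sum fun ω _ => mul_le_mul_of_nonneg_left (h _) (Nat.cast_nonneg _)

theorem excess_eq_of_forall [Finite X] (ρ : H →* Equiv.Perm X)
    [FiniteDimensional ℚ (actionCocycles ρ)] (c : ℝ) (h : ∀ x, bettiRatio H (stab ρ x) = c) :
    excess ρ = Nat.card X * c := by
  let _ := MulAction.compHom X ρ
  rw [excess_eq, card_eq_finsum_card_orbit H X, finsum_mul' _ _ (Set.toFinite _)]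
  simp only [h]

theorem excess_of_free [Finite H] [Finite X] (ρ : H →* Equiv.Perm X)
    (h : ∀ x g, ρ g x = x → g = 1) : excess ρ = - (Nat.card X * (1 / (Nat.card H : ℝ))) := by
  rw [excess_eq_of_forall ρ (-(1 / (Nat.card H : ℝ))), mul_neg]
  intro x
  have h1 : (stab ρ x).1 = ⊥ := (Subgroup.eq_bot_iff_forall _).2 fun g hg => h x g hg
  rw [bettiRatio, h1, firstBetti_of_subsingleton, Subgroup.index_bot]
  push_cast
  ring

/-- All point stabilizers are conjugates of `K`, so they share its Betti ratio. -/
theorem excess_coset {G : Type*} [Group G] (K : FinIndexSubgroup G) [Finite (G ⧸ K.1)]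
    [FiniteDimensional ℚ (actionCocycles (MulAction.toPermHom G (G ⧸ K.1)))] :
    excess (MulAction.toPermHom G (G ⧸ K.1)) = Nat.card (G ⧸ K.1) * bettiRatio G K := by
  refine excess_eq_of_forall _ _ fun x => ?_
  obtain ⟨a, rfl⟩ := QuotientGroup.mk_surjective x
  refine bettiRatio_conj _ _ a fun g => ?_
  rw [mem_stab, eq_comm]
  refine QuotientGroup.eq.trans ?_
  rw [mul_assoc]
  rfl

end actionCocycles

/-! ### Free actions of finite groups, and potentials on forests -/

/-- Every orbit is a copy of `A`, so equal cardinalities give equally many orbits; a matching of the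
orbits extends equivariantly from representatives. -/
theorem MulAction.exists_equivariant_equiv_of_free {A X Y : Type*} [Group A] [Finite A] [Finite X]
    [Finite Y] [MulAction A X] [MulAction A Y] (hX : ∀ (x : X) (a : A), a • x = x → a = 1)
    (hY : ∀ (y : Y) (a : A), a • y = y → a = 1) (hXY : Nat.card X = Nat.card Y) :
    ∃ c : X ≃ Y, ∀ (a : A) x, c (a • x) = a • c x := by
  have cX := Nat.card_congr (MulAction.selfEquivOrbitsQuotientProd (G := A) (X := X)
    fun x => (Subgroup.eq_bot_iff_forall _).2 fun g hg => hX x g hg)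
  have cY := Nat.card_congr (MulAction.selfEquivOrbitsQuotientProd (G := A) (X := Y)
    fun x => (Subgroup.eq_bot_iff_forall _).2 fun g hg => hY x g hg)
  rw [Nat.card_prod] at cX cY
  have hΩ : Nat.card (orbitRel.Quotient A X) = Nat.card (orbitRel.Quotient A Y) :=
    Nat.eq_of_mul_eq_mul_right Nat.card_pos (cX.symm.trans (hXY.trans cY))
  let j : orbitRel.Quotient A X ≃ orbitRel.Quotient A Y := (Finite.card_eq.1 hΩ).some
  let c : X → Y := fun x => actionCocycles.toPoint A x • (j (Quotient.mk _ x)).out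
  have hfree : ∀ (y : Y) (a b : A), a • y = b • y → a = b := by
    intro y a b h
    refine (inv_mul_eq_one.1 (hY y _ ?_)).symm
    rw [mul_smul, inv_smul_eq_iff, h]
  have hc : ∀ (a : A) x, c (a • x) = a • c x := by
    intro a x
    have h1 := actionCocycles.toPoint_smul (H := A) (a • x)
    have h2 := actionCocycles.toPoint_smul (H := A) x
    rw [actionCocycles.mk_smul_eq] at h1
    have h3 : actionCocycles.toPoint A (a • x) = a * actionCocycles.toPoint A x := by
      refine (inv_mul_eq_one.1 (hX (Quotient.mk (orbitRel A X) x).out _ ?_)).symm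
      rw [mul_smul, inv_smul_eq_iff, h1, mul_smul, h2]
    simp only [c]
    rw [h3, mul_smul, actionCocycles.mk_smul_eq]
  have hinj : Function.Injective c := by
    intro x y h
    have h1 : Quotient.mk (orbitRel A X) x = Quotient.mk _ y := by
      have := congrArg (Quotient.mk (orbitRel A Y)) h
      simp only [c] at this
      rw [actionCocycles.mk_smul_eq, actionCocycles.mk_smul_eq, Quotient.out_eq,
        Quotient.out_eq] at this
      exact j.injective this
    simp only [c, h1] at h
    have h2 := hfree _ _ _ h
    rw [← actionCocycles.toPoint_smul (H := A) x, ← actionCocycles.toPoint_smul (H := A) y, h1, h2]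
  exact ⟨Equiv.ofBijective c ((Nat.bijective_iff_injective_and_card c).2 ⟨hinj, hXY⟩), hc⟩

theorem Equiv.Perm.exists_conj_of_free {A X : Type*} [Group A] [Finite A] [Finite X]
    (α β : A →* Equiv.Perm X) (hα : ∀ x a, α a x = x → a = 1) (hβ : ∀ x a, β a x = x → a = 1) :
    ∃ c : Equiv.Perm X, ∀ a, c * α a * c⁻¹ = β a := by
  obtain ⟨c, hc⟩ := @MulAction.exists_equivariant_equiv_of_free A X X _ _ _ _
    (MulAction.compHom X α) (MulAction.compHom X β) hα hβ rfl
  refine ⟨c, fun a => ?_⟩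
  rw [mul_inv_eq_iff_eq_mul]
  exact Equiv.ext (hc a)

theorem SimpleGraph.IsAcyclic.exists_potential {V E P : Type*} [Group P] (src tgt : E → V)
    (T : Finset E) (hloop : ∀ e ∈ T, src e ≠ tgt e)
    (hinj : Set.InjOn (fun e => s(src e, tgt e)) (T : Set E))
    (hT : (SimpleGraph.fromEdgeSet ((fun e => s(src e, tgt e)) '' (T : Set E))).IsAcyclic)
    (c : E → P) : ∃ s : V → P, ∀ e ∈ T, s (tgt e) = s (src e) * c e := by
  classical
  induction T using Finset.induction_on with
  | empty => exact ⟨fun _ => 1, by simp⟩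
  | insert e F he ih =>
    have hF : (SimpleGraph.fromEdgeSet ((fun e => s(src e, tgt e)) '' (F : Set E))) ≤
        SimpleGraph.fromEdgeSet ((fun e => s(src e, tgt e)) '' ((insert e F : Finset E) : Set E)) :=
      SimpleGraph.fromEdgeSet_mono (Set.image_mono (by simp))
    obtain ⟨s, hs⟩ := ih (fun e he => hloop e (Finset.mem_insert_of_mem he))
      (hinj.mono (by simp)) (hT.anti hF)
    set Γ := SimpleGraph.fromEdgeSet ((fun e => s(src e, tgt e)) '' (F : Set E)) with hΓ
    have hadj : (SimpleGraph.fromEdgeSet ((fun e => s(src e, tgt e)) ''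
        ((insert e F : Finset E) : Set E))).Adj (src e) (tgt e) := by
      rw [SimpleGraph.fromEdgeSet_adj]
      exact ⟨⟨e, by simp, rfl⟩, hloop e (Finset.mem_insert_self _ _)⟩
    have hnot : ¬ Γ.Reachable (src e) (tgt e) := by
      have h := SimpleGraph.isAcyclic_iff_forall_adj_isBridge.1 hT hadj
      rw [SimpleGraph.isBridge_iff] at h
      refine fun hr => h (hr.mono ?_)
      intro x y hxy
      rw [SimpleGraph.deleteEdges_adj]
      refine ⟨hF hxy, ?_⟩
      rw [hΓ, SimpleGraph.fromEdgeSet_adj] at hxy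
      obtain ⟨⟨f, hf, hfe⟩, -⟩ := hxy
      intro h
      have : f = e := hinj (by simp [Finset.mem_coe.1 hf]) (by simp)
        (hfe.trans (Set.mem_singleton_iff.1 h))
      exact he (this ▸ hf)
    -- The new edge is a bridge. Left multiplication by a constant on the component of its far end
    -- keeps the old relations, and this constant is the one that the new relation forces.
    let g : P := s (src e) * c e * (s (tgt e))⁻¹
    refine ⟨fun v => if Γ.Reachable (tgt e) v then g * s v else s v, fun f hf => ?_⟩
    rcases Finset.mem_insert.1 hf with rfl | hf'
    · beta_reduce
      rw [if_pos SimpleGraph.Reachable.rfl, if_neg fun h => hnot h.symm]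
      simp [g]
    · have hfa : Γ.Adj (src f) (tgt f) := by
        rw [hΓ, SimpleGraph.fromEdgeSet_adj]
        exact ⟨⟨f, hf', rfl⟩, hloop f hf⟩
      have : Γ.Reachable (tgt e) (src f) ↔ Γ.Reachable (tgt e) (tgt f) :=
        ⟨fun h => h.trans hfa.reachable, fun h => h.trans hfa.symm.reachable⟩
      beta_reduce
      by_cases h : Γ.Reachable (tgt e) (tgt f)
      · rw [if_pos h, if_pos (this.2 h), hs f hf', ← mul_assoc]
      · rw [if_neg h, if_neg (mt this.1 h), hs f hf']

theorem Equiv.Perm.apply_inv_apply {X : Type*} (σ : Equiv.Perm X) (x : X) : σ (σ⁻¹ x) = x :=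
  σ.apply_symm_apply x

theorem Equiv.Perm.inv_apply_apply {X : Type*} (σ : Equiv.Perm X) (x : X) : σ⁻¹ (σ x) = x :=
  σ.symm_apply_apply x

/-! ### Cocycles as lifts to skew permutations -/

/-- The skew permutation `(x, q) ↦ (σ x, q + n x)`. -/
def skewPerm {X : Type*} (σ : Equiv.Perm X) (n : X → ℚ) : Equiv.Perm (X × ℚ) :=
  Equiv.prodShear σ fun x => Equiv.addRight (n x)

theorem skewPerm_apply {X : Type*} (σ : Equiv.Perm X) (n : X → ℚ) (x : X) (q : ℚ) :
    skewPerm σ n (x, q) = (σ x, q + n x) := rfl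

theorem skewPerm_mul {X : Type*} (σ τ : Equiv.Perm X) (n m : X → ℚ) :
    skewPerm σ n * skewPerm τ m = skewPerm (σ * τ) fun x => m x + n (τ x) := by
  ext p : 1
  obtain ⟨x, q⟩ := p
  simp only [Equiv.Perm.mul_apply, skewPerm_apply, add_assoc]

theorem skewPerm_one {X : Type*} : skewPerm (1 : Equiv.Perm X) 0 = 1 := by
  ext p : 1
  obtain ⟨x, q⟩ := p
  simp [skewPerm_apply]

namespace actionCocycles

variable {H X : Type*} [Group H]

/-- The skew representation defined by a cocycle. -/
def toSkew {ρ : H →* Equiv.Perm X} (f : actionCocycles ρ) : H →* Equiv.Perm (X × ℚ) :=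
  MonoidHom.mk' (fun g => skewPerm (ρ g) (f.1 g)) fun g h => by
    rw [skewPerm_mul, map_mul]
    congr 1
    funext x
    rw [cocycle_mul, add_comm]

theorem toSkew_apply {ρ : H →* Equiv.Perm X} (f : actionCocycles ρ) (g : H) :
    toSkew f g = skewPerm (ρ g) (f.1 g) := rfl

/-- The second coordinate of `Ψ (g * h) = Ψ g * Ψ h` is the cocycle rule. Cocycles can thus be built
from homomorphisms. -/
theorem exists_of_skew (ρ : H →* Equiv.Perm X) (Ψ : H →* Equiv.Perm (X × ℚ))
    (h : ∀ g, ∃ n, Ψ g = skewPerm (ρ g) n) :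
    ∃ f : actionCocycles ρ, ∀ g, Ψ g = skewPerm (ρ g) (f.1 g) := by
  choose n hn using h
  refine ⟨⟨n, fun g h x => ?_⟩, hn⟩
  have h1 := congrArg (fun σ => (σ (x, (0 : ℚ))).2) (Ψ.map_mul g h)
  simp only [hn, skewPerm_mul, skewPerm_apply, zero_add] at h1
  rw [h1, add_comm]

/-- Cocycles of conjugate representations correspond. -/
def twist {α β : H →* Equiv.Perm X} (c : Equiv.Perm X) (h : ∀ a, c * β a = α a * c) :
    actionCocycles β →ₗ[ℚ] actionCocycles α where
  toFun f := ⟨fun a y => f.1 a (c⁻¹ y), fun g g' x => by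
    have h1 : c⁻¹ (α g' x) = β g' (c⁻¹ x) := by
      rw [Equiv.Perm.inv_eq_iff_eq, ← Equiv.Perm.mul_apply, h, Equiv.Perm.mul_apply,
        Equiv.Perm.apply_inv_apply]
    beta_reduce
    rw [cocycle_mul, h1]⟩
  map_add' _ _ := rfl
  map_smul' _ _ := rfl

theorem twist_apply {α β : H →* Equiv.Perm X} (c : Equiv.Perm X) (h : ∀ a, c * β a = α a * c)
    (f : actionCocycles β) (a : H) (y : X) : (twist c h f).1 a y = f.1 a (c⁻¹ y) := rfl

end actionCocycles

/-! ### The exact sequence of cocycles for a graph of groups -/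

namespace GraphOfGroups

variable {V : Type u} {E : Type v} (𝒢 : GraphOfGroups.{u, v, w, x} V E) (T : Set E)

/-- The canonical homomorphism from a vertex group to the fundamental group. -/
def of (u : V) : 𝒢.vertexGroup u →* 𝒢.FundamentalGroup T :=
  (QuotientGroup.mk' _).comp (𝒢.preOf u)

/-- The stable letter of an edge in the fundamental group. -/
def stableLetter (e : E) : 𝒢.FundamentalGroup T := QuotientGroup.mk' _ (𝒢.preT e)

theorem stableLetter_mul (e : E) (a : 𝒢.edgeGroup e) :
    𝒢.stableLetter T e * 𝒢.of T (𝒢.tgt e) (𝒢.toTgt e a) =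
      𝒢.of T (𝒢.src e) (𝒢.toSrc e a) * 𝒢.stableLetter T e := by
  have h : QuotientGroup.mk' (Subgroup.normalClosure (𝒢.relators T))
      (𝒢.preT e * 𝒢.preOf (𝒢.tgt e) (𝒢.toTgt e a) * (𝒢.preT e)⁻¹ *
        (𝒢.preOf (𝒢.src e) (𝒢.toSrc e a))⁻¹) = 1 :=
    (QuotientGroup.eq_one_iff _).2 (Subgroup.subset_normalClosure (Or.inl ⟨e, a, rfl⟩))
  rw [map_mul, map_mul, map_mul, map_inv, map_inv, mul_inv_eq_one, mul_inv_eq_iff_eq_mul] at h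
  exact h

variable {T} in
theorem stableLetter_eq_one {e : E} (he : e ∈ T) : 𝒢.stableLetter T e = 1 :=
  (QuotientGroup.eq_one_iff _).2 (Subgroup.subset_normalClosure (Or.inr ⟨e, he, rfl⟩))

theorem induction_on {p : 𝒢.FundamentalGroup T → Prop} (g : 𝒢.FundamentalGroup T)
    (hof : ∀ u a, p (𝒢.of T u a)) (ht : ∀ e, p (𝒢.stableLetter T e))
    (hone : p 1) (hmul : ∀ a b, p a → p b → p (a * b)) (hinv : ∀ a, p a → p a⁻¹) : p g := by
  obtain ⟨g, rfl⟩ := QuotientGroup.mk'_surjective _ g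
  induction g using Monoid.Coprod.induction_on with
  | inl m =>
    induction m using Monoid.CoprodI.induction_on with
    | one => rw [map_one, map_one]; exact hone
    | of u a => exact hof u a
    | mul a b ha hb => rw [map_mul, map_mul]; exact hmul _ _ ha hb
  | inr n =>
    induction n using FreeGroup.induction_on with
    | C1 => rw [map_one, map_one]; exact hone
    | of e => exact ht e
    | inv_of e _ => rw [map_inv, map_inv]; exact hinv _ (ht e)
    | mul a b ha hb => rw [map_mul, map_mul]; exact hmul _ _ ha hb
  | mul a b ha hb => rw [map_mul]; exact hmul _ _ ha hb

variable {T} in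
theorem exists_lift {P : Type*} [Group P] (φ : ∀ u, 𝒢.vertexGroup u →* P) (c : E → P)
    (hc : ∀ e a, c e * φ (𝒢.tgt e) (𝒢.toTgt e a) = φ (𝒢.src e) (𝒢.toSrc e a) * c e)
    (hT : ∀ e ∈ T, c e = 1) :
    ∃ Φ : 𝒢.FundamentalGroup T →* P, (∀ u a, Φ (𝒢.of T u a) = φ u a) ∧
      ∀ e, Φ (𝒢.stableLetter T e) = c e := by
  let F : 𝒢.PreGroup →* P := Monoid.Coprod.lift (Monoid.CoprodI.lift φ) (FreeGroup.lift c)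
  have hF : ∀ u a, F (𝒢.preOf u a) = φ u a := fun u a => by
    simp [F, preOf]
  have hFt : ∀ e, F (𝒢.preT e) = c e := fun e => by
    simp [F, preT]
  have hker : Subgroup.normalClosure (𝒢.relators T) ≤ F.ker := by
    refine Subgroup.normalClosure_le_normal ?_
    rintro r (⟨e, a, rfl⟩ | ⟨e, he, rfl⟩)
    · rw [SetLike.mem_coe, MonoidHom.mem_ker, map_mul, map_mul, map_mul, map_inv, map_inv, hF, hF,
        hFt, hc, mul_inv_cancel_right, mul_inv_cancel]
    · rw [SetLike.mem_coe, MonoidHom.mem_ker, hFt, hT e he]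
  exact ⟨QuotientGroup.lift _ F hker, hF, hFt⟩

variable {X : Type*} (ρ : 𝒢.FundamentalGroup T →* Equiv.Perm X)

open actionCocycles

/-- The restriction of a permutation representation to an edge group. -/
abbrev edgeRep (e : E) : 𝒢.edgeGroup e →* Equiv.Perm X :=
  (ρ.comp (𝒢.of T (𝒢.src e))).comp (𝒢.toSrc e)

/-- A cocycle of the fundamental group restricts to cocycles of the vertex groups and to values on
the stable letters. -/
def restrict : actionCocycles ρ →ₗ[ℚ]
    (∀ u, actionCocycles (ρ.comp (𝒢.of T u))) × (E → X → ℚ) where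
  toFun f := (fun u => comap (𝒢.of T u) f, fun e => f.1 (𝒢.stableLetter T e))
  map_add' _ _ := rfl
  map_smul' _ _ := rfl

theorem restrict_injective : Function.Injective (𝒢.restrict T ρ) := by
  intro f f' h
  have key : ∀ g, f.1 g = f'.1 g := by
    intro g
    induction g using 𝒢.induction_on T with
    | hof u a => exact congrFun (congrArg Subtype.val (congrFun (congrArg Prod.fst h) u)) a
    | ht e => exact congrFun (congrArg Prod.snd h) e
    | hone => funext x; rw [cocycle_one f, cocycle_one f']
    | hmul y z hy hz => funext x; rw [cocycle_mul f, cocycle_mul f', hy, hz]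
    | hinv y hy => funext x; rw [cocycle_inv f, cocycle_inv f', hy]
  exact Subtype.ext (funext key)

theorem rep_stableLetter_mul (e : E) (a : 𝒢.edgeGroup e) :
    ρ (𝒢.stableLetter T e) * ((ρ.comp (𝒢.of T (𝒢.tgt e))).comp (𝒢.toTgt e)) a =
      𝒢.edgeRep T ρ e a * ρ (𝒢.stableLetter T e) := by
  simp only [edgeRep, MonoidHom.comp_apply, ← map_mul, stableLetter_mul]

/-- The obstruction for cocycles of the vertex groups and values on the stable letters to come from
a cocycle of the fundamental group. -/
def obstruction : ((∀ u, actionCocycles (ρ.comp (𝒢.of T u))) × (E → X → ℚ)) →ₗ[ℚ]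
    (∀ e, actionCocycles (𝒢.edgeRep T ρ e)) × (T → X → ℚ) where
  toFun p := (fun e => comap (𝒢.toSrc e) (p.1 (𝒢.src e)) -
      twist (ρ (𝒢.stableLetter T e)) (𝒢.rep_stableLetter_mul T ρ e)
        (comap (𝒢.toTgt e) (p.1 (𝒢.tgt e))) -
      coboundary _ (fun y => p.2 e ((ρ (𝒢.stableLetter T e))⁻¹ y)), fun e => p.2 e)
  map_add' p q := by
    refine Prod.ext (funext fun e => Subtype.ext (funext fun a => funext fun y => ?_)) rfl
    simp [twist_apply]
    ring
  map_smul' c p := by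
    refine Prod.ext (funext fun e => Subtype.ext (funext fun a => funext fun y => ?_)) rfl
    simp [twist_apply]
    ring

theorem obstruction_fst_apply (p : (∀ u, actionCocycles (ρ.comp (𝒢.of T u))) × (E → X → ℚ))
    (e : E) (a : 𝒢.edgeGroup e) (y : X) :
    ((𝒢.obstruction T ρ p).1 e).1 a y =
      (p.1 (𝒢.src e)).1 (𝒢.toSrc e a) y -
        (p.1 (𝒢.tgt e)).1 (𝒢.toTgt e a) ((ρ (𝒢.stableLetter T e))⁻¹ y) -
        (p.2 e ((ρ (𝒢.stableLetter T e))⁻¹ (ρ (𝒢.of T (𝒢.src e) (𝒢.toSrc e a)) y)) -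
          p.2 e ((ρ (𝒢.stableLetter T e))⁻¹ y)) := rfl

/-- Vanishing obstruction says precisely that the skew permutations attached to the generators
satisfy the defining relations, so the universal property yields a skew lift of `ρ`, that is, a
cocycle. -/
theorem ker_obstruction : LinearMap.ker (𝒢.obstruction T ρ) = LinearMap.range (𝒢.restrict T ρ) := by
  ext p
  rw [LinearMap.mem_ker, LinearMap.mem_range]
  have hinv : ∀ e a x, (ρ (𝒢.stableLetter T e))⁻¹ (ρ (𝒢.of T (𝒢.src e) (𝒢.toSrc e a))
      (ρ (𝒢.stableLetter T e) x)) = ρ (𝒢.of T (𝒢.tgt e) (𝒢.toTgt e a)) x := by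
    intro e a x
    rw [Equiv.Perm.inv_eq_iff_eq, ← Equiv.Perm.mul_apply, ← Equiv.Perm.mul_apply, ← map_mul,
      ← map_mul, stableLetter_mul]
  constructor
  · intro h
    have h1 : ∀ e a x, (p.1 (𝒢.src e)).1 (𝒢.toSrc e a) (ρ (𝒢.stableLetter T e) x) -
        (p.1 (𝒢.tgt e)).1 (𝒢.toTgt e a) x -
        (p.2 e (ρ (𝒢.of T (𝒢.tgt e) (𝒢.toTgt e a)) x) - p.2 e x) = 0 := by
      intro e a x
      have h2 := 𝒢.obstruction_fst_apply T ρ p e a (ρ (𝒢.stableLetter T e) x)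
      rw [h, hinv, Equiv.Perm.inv_apply_apply] at h2
      exact h2.symm
    have h2 : ∀ e ∈ T, p.2 e = 0 := fun e he => congrFun (congrArg Prod.snd h) ⟨e, he⟩
    obtain ⟨Ψ, hΨ, hΨt⟩ := 𝒢.exists_lift (T := T) (fun u => toSkew (p.1 u))
      (fun e => skewPerm (ρ (𝒢.stableLetter T e)) (p.2 e)) (by
        intro e a
        rw [toSkew_apply, toSkew_apply, skewPerm_mul, skewPerm_mul]
        congr 1
        · exact 𝒢.rep_stableLetter_mul T ρ e a
        · funext x
          have := h1 e a x
          simp only [MonoidHom.comp_apply]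
          linarith) (by
        intro e he
        rw [h2 e he, 𝒢.stableLetter_eq_one he, map_one, skewPerm_one])
    -- Being skew over `ρ` passes to products and inverses, hence from the generators to the whole
    -- group.
    obtain ⟨f, hf⟩ := exists_of_skew ρ Ψ (by
      intro g
      induction g using 𝒢.induction_on T with
      | hof u a => exact ⟨_, hΨ u a⟩
      | ht e => exact ⟨_, hΨt e⟩
      | hone => exact ⟨0, by rw [map_one, map_one, skewPerm_one]⟩
      | hmul y z hy hz =>
        obtain ⟨n, hn⟩ := hy
        obtain ⟨m, hm⟩ := hz
        exact ⟨_, by rw [map_mul, map_mul, hn, hm, skewPerm_mul]⟩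
      | hinv y hy =>
        obtain ⟨n, hn⟩ := hy
        refine ⟨fun x => - n ((ρ y)⁻¹ x), ?_⟩
        rw [map_inv, map_inv, inv_eq_iff_mul_eq_one, hn, skewPerm_mul, mul_inv_cancel,
          ← skewPerm_one]
        congr 1
        funext x
        simp)
    have hskew : ∀ (σ : Equiv.Perm X) (n m : X → ℚ), skewPerm σ n = skewPerm σ m → n = m := by
      intro σ n m h
      funext x
      have := congrArg (fun τ => (τ (x, (0 : ℚ))).2) h
      simpa [skewPerm_apply] using this
    refine ⟨f, Prod.ext (funext fun u => Subtype.ext (funext fun a => ?_)) (funext fun e => ?_)⟩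
    · exact hskew _ _ _ ((hf _).symm.trans (hΨ u a))
    · exact hskew _ _ _ ((hf _).symm.trans (hΨt e))
  · rintro ⟨f, rfl⟩
    refine Prod.ext (funext fun e => Subtype.ext (funext fun a => funext fun y => ?_))
      (funext fun e => funext fun x => ?_)
    · obtain ⟨x, rfl⟩ := (ρ (𝒢.stableLetter T e)).surjective y
      rw [obstruction_fst_apply, hinv, Equiv.Perm.inv_apply_apply]
      have h1 := cocycle_mul f (𝒢.stableLetter T e) (𝒢.of T (𝒢.tgt e) (𝒢.toTgt e a)) x
      have h2 := cocycle_mul f (𝒢.of T (𝒢.src e) (𝒢.toSrc e a)) (𝒢.stableLetter T e) x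
      rw [stableLetter_mul] at h1
      change f.1 (𝒢.of T (𝒢.src e) (𝒢.toSrc e a)) (ρ (𝒢.stableLetter T e) x) -
        f.1 (𝒢.of T (𝒢.tgt e) (𝒢.toTgt e a)) x -
        (f.1 (𝒢.stableLetter T e) (ρ (𝒢.of T (𝒢.tgt e) (𝒢.toTgt e a)) x) -
          f.1 (𝒢.stableLetter T e) x) = 0
      linarith
    · change f.1 (𝒢.stableLetter T e) x = 0
      rw [𝒢.stableLetter_eq_one e.2, cocycle_one]

variable {𝒢 T}

theorem IsSpanningTree.exists_potential [Fintype E] (hT : 𝒢.IsSpanningTree T) {P : Type*} [Group P]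
    (c : E → P) : ∃ s : V → P, ∀ e ∈ T, s (𝒢.tgt e) = s (𝒢.src e) * c e := by
  classical
  obtain ⟨s, hs⟩ := SimpleGraph.IsAcyclic.exists_potential 𝒢.src 𝒢.tgt T.toFinset
    (fun e he => by simpa [ends] using hT.not_loop e (Set.mem_toFinset.1 he))
    (by rw [Set.coe_toFinset]; exact hT.injOn_ends)
    (by rw [Set.coe_toFinset]; exact hT.isTree.isAcyclic) c
  exact ⟨s, fun e he => hs e (Set.mem_toFinset.2 he)⟩

theorem IsSpanningTree.ncard_add_one [Fintype V] [Fintype E] (hT : 𝒢.IsSpanningTree T) :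
    T.ncard + 1 = Fintype.card V := by
  classical
  rw [← hT.isTree.card_edgeFinset, ← hT.injOn_ends.ncard_image,
    Set.ncard_eq_toFinset_card']
  congr 2
  ext z
  simp only [Set.mem_toFinset, SimpleGraph.mem_edgeFinset, SimpleGraph.edgeSet_fromEdgeSet]
  refine ⟨fun h => ⟨h, ?_⟩, fun h => h.1⟩
  obtain ⟨e, he, rfl⟩ := h
  exact hT.not_loop e he

/-- Each edge cocycle is a coboundary of some `n e`. Coboundaries of potentials `w u` at the
vertices, with stable letter values determined by `w` and `n`, meet all edge conditions. The tree
conditions then prescribe the differences of `w` along `T`, which is solvable since `T` is acyclic.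
-/
theorem IsSpanningTree.obstruction_surjective [Fintype E] (hT : 𝒢.IsSpanningTree T)
    [∀ e, Finite (𝒢.edgeGroup e)] : Function.Surjective (𝒢.obstruction T ρ) := by
  classical
  rintro ⟨β, γ⟩
  choose n hn using fun e => exists_coboundary_eq (β e)
  obtain ⟨w, hw⟩ := hT.exists_potential (P := Multiplicative (X → ℚ))
    fun e => Multiplicative.ofAdd (if h : e ∈ T then - γ ⟨e, h⟩ - n e else 0)
  refine ⟨(fun u => coboundary _ (w u).toAdd, fun e x =>
    (w (𝒢.src e)).toAdd (ρ (𝒢.stableLetter T e) x) - n e (ρ (𝒢.stableLetter T e) x) -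
      (w (𝒢.tgt e)).toAdd x), ?_⟩
  refine Prod.ext (funext fun e => Subtype.ext (funext fun a => funext fun y => ?_))
      (funext fun e => funext fun x => ?_)
  · obtain ⟨x, rfl⟩ := (ρ (𝒢.stableLetter T e)).surjective y
    rw [obstruction_fst_apply, show (β, γ).1 e = _ from (hn e).symm]
    have h1 := Equiv.congr_fun (𝒢.rep_stableLetter_mul T ρ e a) x
    simp only [Equiv.Perm.mul_apply, MonoidHom.comp_apply] at h1
    simp only [coboundary_apply, MonoidHom.comp_apply,
      Equiv.Perm.inv_apply_apply, ← h1]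
    ring
  · have h1 := congrFun (congrArg Multiplicative.toAdd (hw e e.2)) x
    rw [toAdd_mul, toAdd_ofAdd, dif_pos e.2] at h1
    change _ - n e (ρ (𝒢.stableLetter T e) x) - (w (𝒢.tgt e)).toAdd x = γ e x
    rw [h1, 𝒢.stableLetter_eq_one e.2, map_one]
    simp
    ring

theorem finiteDimensional_cocycles [Fintype V] [Fintype E] [Finite X]
    [∀ u, Group.FG (𝒢.vertexGroup u)] : FiniteDimensional ℚ (actionCocycles ρ) :=
  FiniteDimensional.of_injective _ (𝒢.restrict_injective T ρ)

/-- Rank–nullity for the obstruction map; the multiples of `|X|` balance because `|V| = |T| + 1`. -/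
theorem IsSpanningTree.excess_eq [Fintype V] [Fintype E] [Finite X] (hT : 𝒢.IsSpanningTree T)
    [∀ u, Group.FG (𝒢.vertexGroup u)] [∀ e, Finite (𝒢.edgeGroup e)] :
    excess ρ = ∑ u, excess (ρ.comp (𝒢.of T u)) - ∑ e, excess (𝒢.edgeRep T ρ e) := by
  classical
  have := Fintype.ofFinite X
  have h := LinearMap.finrank_range_add_finrank_ker (𝒢.obstruction T ρ)
  rw [LinearMap.range_eq_top.2 (hT.obstruction_surjective ρ), finrank_top, ker_obstruction,
    LinearMap.finrank_range_of_inj (𝒢.restrict_injective T ρ), Module.finrank_prod,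
    Module.finrank_prod, Module.finrank_pi_fintype,
    Module.finrank_pi_fintype ℚ (M := fun _ : T => X → ℚ),
    Module.finrank_pi_fintype ℚ (M := fun u => actionCocycles (ρ.comp (𝒢.of T u))),
    Module.finrank_pi_fintype ℚ (M := fun _ : E => X → ℚ)] at h
  simp only [Module.finrank_fintype_fun_eq_card, Finset.sum_const, Finset.card_univ,
    smul_eq_mul] at h
  have h2 := hT.ncard_add_one
  rw [Set.ncard_eq_toFinset_card', Set.toFinset_card] at h2
  have h' : (∑ e, (Module.finrank ℚ (actionCocycles (𝒢.edgeRep T ρ e)) : ℝ)) +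
      Fintype.card T * Fintype.card X + Module.finrank ℚ (actionCocycles ρ) =
      (∑ u, (Module.finrank ℚ (actionCocycles (ρ.comp (𝒢.of T u))) : ℝ)) +
        Fintype.card E * Fintype.card X := by exact_mod_cast h
  have h2' : (Fintype.card V : ℝ) = Fintype.card T + 1 := by exact_mod_cast h2.symm
  simp only [excess, Finset.sum_sub_distrib, Finset.sum_const, Finset.card_univ, nsmul_eq_mul,
    Nat.card_eq_fintype_card, h2']
  linarith

end GraphOfGroups

/-! ### Estimates for the Betti volume, and finite actions of one group -/

section BettiVolume

variable {G : Type*} [Group G]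

theorem isBoundedUnder_bettiRatio [Group.FG G] :
    Filter.IsBoundedUnder (· ≤ ·) Filter.atBot (bettiRatio G) :=
  Filter.isBoundedUnder_of ⟨Group.rank G + 1, fun H => (abs_le.1 (abs_bettiRatio_le G H)).2⟩

theorem isCoboundedUnder_bettiRatio [Group.FG G] :
    Filter.IsCoboundedUnder (· ≤ ·) Filter.atBot (bettiRatio G) :=
  (Filter.isBoundedUnder_of ⟨-(Group.rank G + 1 : ℝ), fun H =>
    (abs_le.1 (abs_bettiRatio_le G H)).1⟩ :
      Filter.IsBoundedUnder (· ≥ ·) Filter.atBot (bettiRatio G)).isCoboundedUnder_le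

theorem exists_forall_bettiRatio_le [Group.FG G] {ε : ℝ} (hε : 0 < ε) :
    ∃ H : FinIndexSubgroup G, ∀ K ≤ H, bettiRatio G K ≤ bettiVolume G + ε := by
  have h := Filter.eventually_lt_of_limsup_lt (lt_add_of_pos_right (bettiVolume G) hε)
    isBoundedUnder_bettiRatio
  obtain ⟨H, hH⟩ := Filter.eventually_atBot.1 h
  exact ⟨H, fun K hK => (hH K hK).le⟩

theorem exists_le_bettiRatio [Group.FG G] {ε : ℝ} (hε : 0 < ε) (H : FinIndexSubgroup G) :
    ∃ K ≤ H, bettiVolume G - ε ≤ bettiRatio G K := by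
  have h := Filter.frequently_lt_of_lt_limsup isCoboundedUnder_bettiRatio
    (sub_lt_self (bettiVolume G) hε)
  obtain ⟨K, hK, h⟩ := Filter.frequently_atBot.1 h H
  exact ⟨K, hK, h.le⟩

theorem bettiVolume_eq_of_forall (L : ℝ)
    (h₁ : ∀ ε > 0, ∃ H : FinIndexSubgroup G, ∀ K ≤ H, bettiRatio G K ≤ L + ε)
    (h₂ : ∀ ε > 0, ∀ H : FinIndexSubgroup G, ∃ K ≤ H, L - ε ≤ bettiRatio G K) :
    bettiVolume G = L := by
  have f₂ : ∀ ε > 0, ∃ᶠ K in Filter.atBot, L - ε ≤ bettiRatio G K := fun ε hε =>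
    Filter.frequently_atBot.2 (h₂ ε hε)
  have f₁ : ∀ ε > 0, ∀ᶠ K in Filter.atBot, bettiRatio G K ≤ L + ε := fun ε hε =>
    Filter.eventually_atBot.2 (h₁ ε hε)
  refine le_antisymm (le_of_forall_pos_le_add fun ε hε => ?_)
    (le_of_forall_pos_le_add fun ε hε => ?_)
  -- The opposite estimate with `ε = 1` supplies the boundedness that a real upper limit requires,
  -- here and in the next case.
  · exact Filter.limsup_le_of_le (Filter.IsCoboundedUnder.of_frequently_ge (f₂ 1 one_pos)) (f₁ ε hε)
  · have : L - ε ≤ bettiVolume G :=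
      Filter.le_limsup_of_frequently_le (f₂ ε hε) ⟨L + 1, Filter.eventually_map.2 (f₁ 1 one_pos)⟩
    linarith

/-- In a group that is residually finite or virtually torsion free, a finite set of elements of
finite order is separated from the identity by a normal subgroup of finite index. -/
theorem exists_normal_separating (hG : Group.ResiduallyFinite G ∨ IsVirtuallyTorsionFree G)
    (F : Set G) (hF : F.Finite) (hord : ∀ g ∈ F, IsOfFinOrder g) :
    ∃ N : Subgroup G, N.Normal ∧ N.FiniteIndex ∧ ∀ g ∈ F, g ∈ N → g = 1 := by
  rcases hG with hG | ⟨H, hH, htf⟩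
  · induction F, hF using Set.Finite.induction_on with
    | empty => exact ⟨⊤, inferInstance, inferInstance, by simp⟩
    | @insert a S _ _ ih =>
      obtain ⟨N, hN, hNf, h⟩ := ih fun g hg => hord g (Set.mem_insert_of_mem _ hg)
      by_cases ha : a = 1
      · refine ⟨N, hN, hNf, fun g hg hgN => ?_⟩
        rcases hg with rfl | hg
        exacts [ha, h g hg hgN]
      · obtain ⟨M, hM⟩ := Group.exists_finiteIndexNormalSubgroup_notMem a ha
        refine ⟨N ⊓ M.toSubgroup, inferInstance, inferInstance, fun g hg hgN => ?_⟩
        rcases hg with rfl | hg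
        exacts [absurd hgN.2 hM, h g hg hgN.1]
  · exact ⟨H.normalCore, inferInstance, inferInstance, fun g hg hgN =>
      htf g (H.normalCore_le hgN) (hord g hg)⟩

/-- A finite multiple of a transitive action, on a prescribed finite set. -/
theorem exists_rep_stabilizer_conj (K : FinIndexSubgroup G) (N : ℕ) (h : K.1.index ∣ N) :
    ∃ φ : G →* Equiv.Perm (Fin N), ∀ x, ∃ g, ∀ a, φ a x = x ↔ g⁻¹ * a * g ∈ K.1 := by
  have := K.2
  obtain ⟨m, rfl⟩ := h
  have e : ((G ⧸ K.1) × Fin m) ≃ Fin (K.1.index * m) := by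
    refine Finite.equivFinOfCardEq ?_
    rw [Nat.card_prod, Nat.card_fin]
    rfl
  refine ⟨MonoidHom.mk' (fun a => e.symm.trans
    (((MulAction.toPerm a).prodCongr (Equiv.refl _)).trans e)) fun a b => ?_, fun x => ?_⟩
  · ext x : 1
    simp [Prod.map, mul_smul]
  · obtain ⟨⟨y, i⟩, rfl⟩ := e.surjective x
    obtain ⟨g, rfl⟩ := QuotientGroup.mk_surjective y
    refine ⟨g, fun a => ?_⟩
    rw [MonoidHom.mk'_apply, Equiv.trans_apply, Equiv.trans_apply, e.symm_apply_apply,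
      e.apply_eq_iff_eq, Equiv.prodCongr_apply, Prod.map_apply, Prod.mk.injEq, eq_comm]
    refine (and_iff_left rfl).trans (QuotientGroup.eq.trans ?_)
    rw [mul_assoc]
    rfl

theorem coset_rep_apply_eq {A : Type*} [Group A] (K : Subgroup G) (φ : A →* G) (g : G) (a : A) :
    ((MulAction.toPermHom G (G ⧸ K)).comp φ) a (QuotientGroup.mk g) = QuotientGroup.mk g ↔
      g⁻¹ * φ a * g ∈ K := by
  rw [eq_comm]
  refine QuotientGroup.eq.trans ?_
  rw [mul_assoc]
  rfl

end BettiVolume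

/-! ### Finite index subgroups of the fundamental group -/

namespace GraphOfGroups

open actionCocycles

variable {V : Type u} {E : Type v} {𝒢 : GraphOfGroups.{u, v, w, x} V E} {T : Set E}
variable [Fintype E]

-- Finite edge groups have only finitely many images in the vertex groups, all of finite order.
-- Equality in the sigma type says that `g` is such an image without transport along `src e = u`.
variable (𝒢) in
theorem exists_normal_edge_free [∀ e, Finite (𝒢.edgeGroup e)]
    (hres : ∀ u, Group.ResiduallyFinite (𝒢.vertexGroup u) ∨
      IsVirtuallyTorsionFree (𝒢.vertexGroup u)) (u : V) :
    ∃ N : Subgroup (𝒢.vertexGroup u), N.Normal ∧ N.FiniteIndex ∧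
      (∀ e (a : 𝒢.edgeGroup e) (g : 𝒢.vertexGroup u),
        (⟨𝒢.src e, 𝒢.toSrc e a⟩ : Σ u, 𝒢.vertexGroup u) = ⟨u, g⟩ → g ∈ N → g = 1) ∧
      ∀ e (a : 𝒢.edgeGroup e) (g : 𝒢.vertexGroup u),
        (⟨𝒢.tgt e, 𝒢.toTgt e a⟩ : Σ u, 𝒢.vertexGroup u) = ⟨u, g⟩ → g ∈ N → g = 1 := by
  let s : (Σ e, 𝒢.edgeGroup e) → Σ u, 𝒢.vertexGroup u := fun p => ⟨𝒢.src p.1, 𝒢.toSrc p.1 p.2⟩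
  let t : (Σ e, 𝒢.edgeGroup e) → Σ u, 𝒢.vertexGroup u := fun p => ⟨𝒢.tgt p.1, 𝒢.toTgt p.1 p.2⟩
  have hfin : (Set.range s ∪ Set.range t).Finite := (Set.finite_range s).union (Set.finite_range t)
  have hord : ∀ p ∈ Set.range s ∪ Set.range t, IsOfFinOrder p.2 := by
    rintro _ (⟨⟨e, a⟩, rfl⟩ | ⟨⟨e, a⟩, rfl⟩)
    · exact (𝒢.toSrc e).isOfFinOrder (isOfFinOrder_of_finite a)
    · exact (𝒢.toTgt e).isOfFinOrder (isOfFinOrder_of_finite a)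
  obtain ⟨N, hN, hNf, h⟩ := exists_normal_separating (hres u) (Sigma.mk u ⁻¹' _)
    (hfin.preimage sigma_mk_injective.injOn) fun g hg => hord _ hg
  exact ⟨N, hN, hNf, fun e a g hg => h g (Or.inl ⟨⟨e, a⟩, hg⟩),
    fun e a g hg => h g (Or.inr ⟨⟨e, a⟩, hg⟩)⟩

variable [Fintype V]

/-- The excess formula for the action on the cosets of `K`; `hfree` makes the edge groups act freely
there. -/
theorem IsSpanningTree.card_mul_bettiRatio (hT : 𝒢.IsSpanningTree T)
    [∀ u, Group.FG (𝒢.vertexGroup u)] [∀ e, Finite (𝒢.edgeGroup e)]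
    (K : FinIndexSubgroup (𝒢.FundamentalGroup T))
    (hfree : ∀ e a g, g⁻¹ * 𝒢.of T (𝒢.src e) (𝒢.toSrc e a) * g ∈ K.1 → a = 1) :
    Nat.card (𝒢.FundamentalGroup T ⧸ K.1) * bettiRatio _ K =
      ∑ u, excess ((MulAction.toPermHom _ (𝒢.FundamentalGroup T ⧸ K.1)).comp (𝒢.of T u)) +
      Nat.card (𝒢.FundamentalGroup T ⧸ K.1) * ∑ e, 1 / (Nat.card (𝒢.edgeGroup e) : ℝ) := by
  have := K.2
  have := 𝒢.finiteDimensional_cocycles (T := T)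
    (MulAction.toPermHom _ (𝒢.FundamentalGroup T ⧸ K.1))
  rw [← excess_coset, hT.excess_eq, sub_eq_add_neg, Finset.mul_sum, ← Finset.sum_neg_distrib]
  congr 1
  refine Finset.sum_congr rfl fun e _ => ?_
  rw [excess_of_free, neg_neg]
  intro y a h
  obtain ⟨g, rfl⟩ := QuotientGroup.mk_surjective y
  exact hfree e a g ((coset_rep_apply_eq K.1 ((𝒢.of T (𝒢.src e)).comp (𝒢.toSrc e)) g a).1 h)

theorem IsSpanningTree.bettiRatio_le (hT : 𝒢.IsSpanningTree T)
    [∀ u, Group.FG (𝒢.vertexGroup u)] [∀ e, Finite (𝒢.edgeGroup e)]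
    (K : FinIndexSubgroup (𝒢.FundamentalGroup T))
    (hfree : ∀ e a g, g⁻¹ * 𝒢.of T (𝒢.src e) (𝒢.toSrc e a) * g ∈ K.1 → a = 1)
    (c : V → ℝ) (hc : ∀ u g (L : FinIndexSubgroup (𝒢.vertexGroup u)),
      (∀ a, a ∈ L.1 ↔ g⁻¹ * 𝒢.of T u a * g ∈ K.1) → bettiRatio _ L ≤ c u) :
    bettiRatio _ K ≤ ∑ u, c u + ∑ e, 1 / (Nat.card (𝒢.edgeGroup e) : ℝ) := by
  have := K.2
  have hpos : (0 : ℝ) < Nat.card (𝒢.FundamentalGroup T ⧸ K.1) := by exact_mod_cast Nat.card_pos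
  refine le_of_mul_le_mul_left ?_ hpos
  rw [hT.card_mul_bettiRatio K hfree, mul_add, Finset.mul_sum Finset.univ c]
  gcongr with u
  refine excess_le _ _ fun y => ?_
  obtain ⟨g, rfl⟩ := QuotientGroup.mk_surjective y
  exact hc u g _ fun a => coset_rep_apply_eq K.1 (𝒢.of T u) g a

theorem IsSpanningTree.bettiRatio_eq (hT : 𝒢.IsSpanningTree T)
    [∀ u, Group.FG (𝒢.vertexGroup u)] [∀ e, Finite (𝒢.edgeGroup e)]
    (K : FinIndexSubgroup (𝒢.FundamentalGroup T))
    (hfree : ∀ e a g, g⁻¹ * 𝒢.of T (𝒢.src e) (𝒢.toSrc e a) * g ∈ K.1 → a = 1)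
    (c : V → ℝ) (hc : ∀ u g (L : FinIndexSubgroup (𝒢.vertexGroup u)),
      (∀ a, a ∈ L.1 ↔ g⁻¹ * 𝒢.of T u a * g ∈ K.1) → bettiRatio _ L = c u) :
    bettiRatio _ K = ∑ u, c u + ∑ e, 1 / (Nat.card (𝒢.edgeGroup e) : ℝ) := by
  have := K.2
  have hpos : (0 : ℝ) < Nat.card (𝒢.FundamentalGroup T ⧸ K.1) := by exact_mod_cast Nat.card_pos
  refine mul_left_cancel₀ hpos.ne' ?_
  rw [hT.card_mul_bettiRatio K hfree, mul_add, Finset.mul_sum Finset.univ c]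
  congr 1
  refine Finset.sum_congr rfl fun u _ => excess_eq_of_forall _ _ fun y => ?_
  obtain ⟨g, rfl⟩ := QuotientGroup.mk_surjective y
  exact hc u g _ fun a => coset_rep_apply_eq K.1 (𝒢.of T u) g a

/-- Finite actions of the vertex groups in which the edge groups act freely can be glued to a
finite action of the fundamental group. -/
theorem IsSpanningTree.exists_rep (hT : 𝒢.IsSpanningTree T) [∀ e, Finite (𝒢.edgeGroup e)]
    (K : ∀ u, FinIndexSubgroup (𝒢.vertexGroup u))
    (hsrc : ∀ e a g, g⁻¹ * 𝒢.toSrc e a * g ∈ (K (𝒢.src e)).1 → a = 1)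
    (htgt : ∀ e a g, g⁻¹ * 𝒢.toTgt e a * g ∈ (K (𝒢.tgt e)).1 → a = 1) :
    ∃ (N : ℕ) (ρ : 𝒢.FundamentalGroup T →* Equiv.Perm (Fin N)), 0 < N ∧
      ∀ u x, ∃ g, ∀ a, ρ (𝒢.of T u a) x = x ↔ g⁻¹ * a * g ∈ (K u).1 := by
  classical
  -- The product of all indices is a common degree, so every vertex group acts on the same set.
  choose φ hφ using fun u => exists_rep_stabilizer_conj (K u) (∏ u, (K u).1.index)
    (Finset.dvd_prod_of_mem _ (Finset.mem_univ u))
  have hc : ∀ e, ∃ c : Equiv.Perm (Fin (∏ u, (K u).1.index)), ∀ a,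
      c * φ (𝒢.tgt e) (𝒢.toTgt e a) * c⁻¹ = φ (𝒢.src e) (𝒢.toSrc e a) := by
    intro e
    refine Equiv.Perm.exists_conj_of_free ((φ (𝒢.tgt e)).comp (𝒢.toTgt e))
      ((φ (𝒢.src e)).comp (𝒢.toSrc e)) (fun y a h => ?_) (fun y a h => ?_)
    · obtain ⟨g, hg⟩ := hφ (𝒢.tgt e) y
      exact htgt e a g ((hg _).1 h)
    · obtain ⟨g, hg⟩ := hφ (𝒢.src e) y
      exact hsrc e a g ((hg _).1 h)
  choose c hc using hc
  -- Relabelling the set at each vertex by `s` turns the gluing permutations of the tree edges into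
  -- `1`.
  obtain ⟨s, hs⟩ := hT.exists_potential c
  obtain ⟨ρ, hρ, -⟩ := 𝒢.exists_lift (T := T)
    (fun u => (MulAut.conj (s u)).toMonoidHom.comp (φ u))
    (fun e => s (𝒢.src e) * c e * (s (𝒢.tgt e))⁻¹) (by
      intro e a
      simp only [MonoidHom.comp_apply, MulEquiv.toMonoidHom_eq_coe, MonoidHom.coe_coe,
        MulAut.conj_apply, ← hc e a]
      group) (by
      intro e he
      rw [hs e he, mul_inv_cancel])
  refine ⟨_, ρ, Finset.prod_pos fun u _ => Nat.pos_of_ne_zero (K u).2.index_ne_zero,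
    fun u y => ?_⟩
  obtain ⟨g, hg⟩ := hφ u ((s u)⁻¹ y)
  refine ⟨g, fun a => ?_⟩
  rw [hρ, ← hg]
  change s u (φ u a ((s u)⁻¹ y)) = y ↔ _
  rw [Equiv.Perm.eq_inv_iff_eq]

/-- The kernel of a glued action works: on each vertex group it lies in the point stabilizers,
conjugates of a normal `K u` chosen inside `H u` and off the edge groups. -/
theorem IsSpanningTree.exists_normal (hT : 𝒢.IsSpanningTree T) [∀ e, Finite (𝒢.edgeGroup e)]
    (hres : ∀ u, Group.ResiduallyFinite (𝒢.vertexGroup u) ∨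
      IsVirtuallyTorsionFree (𝒢.vertexGroup u))
    (H : ∀ u, FinIndexSubgroup (𝒢.vertexGroup u)) :
    ∃ N : Subgroup (𝒢.FundamentalGroup T), N.Normal ∧ N.FiniteIndex ∧
      (∀ u a, 𝒢.of T u a ∈ N → a ∈ (H u).1) ∧
      ∀ e a, 𝒢.of T (𝒢.src e) (𝒢.toSrc e a) ∈ N → a = 1 := by
  choose N hN hNf hs ht using 𝒢.exists_normal_edge_free hres
  have hnc : ∀ u, ((H u).1.normalCore).FiniteIndex := fun u => by
    have := (H u).2
    infer_instance
  let K : ∀ u, FinIndexSubgroup (𝒢.vertexGroup u) := fun u =>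
    ⟨N u ⊓ (H u).1.normalCore, inferInstance⟩
  have hK : ∀ u, (K u).1.Normal := fun u => inferInstanceAs (N u ⊓ (H u).1.normalCore).Normal
  have hconj : ∀ u (a g : 𝒢.vertexGroup u), g⁻¹ * a * g ∈ (K u).1 → a ∈ (K u).1 := by
    intro u a g h
    have := (hK u).conj_mem _ h g
    rwa [show g * (g⁻¹ * a * g) * g⁻¹ = a by group] at this
  have hsrc : ∀ e a, 𝒢.toSrc e a ∈ (K (𝒢.src e)).1 → a = 1 := fun e a h =>
    𝒢.toSrc_injective e ((hs _ e a _ rfl h.1).trans (map_one _).symm)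
  have htgt : ∀ e a, 𝒢.toTgt e a ∈ (K (𝒢.tgt e)).1 → a = 1 := fun e a h =>
    𝒢.toTgt_injective e ((ht _ e a _ rfl h.1).trans (map_one _).symm)
  obtain ⟨n, ρ, hn, hρ⟩ := hT.exists_rep K (fun e a g h => hsrc e a (hconj _ _ _ h))
    (fun e a g h => htgt e a (hconj _ _ _ h))
  have key : ∀ u a, 𝒢.of T u a ∈ ρ.ker → a ∈ (K u).1 := by
    intro u a h
    obtain ⟨g, hg⟩ := hρ u ⟨0, hn⟩
    exact hconj u a g ((hg a).1 (by rw [MonoidHom.mem_ker.1 h]; rfl))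
  exact ⟨ρ.ker, inferInstance, inferInstance, fun u a h => (H u).1.normalCore_le (key u a h).2,
    fun e a h => hsrc e a (key _ _ h)⟩

end GraphOfGroups

end

/-! ### The two bounds for the Betti volume -/

theorem corollary3p10 {V : Type*} {E : Type*} [Fintype V] [Fintype E]
    (𝒢 : GraphOfGroups V E) (T : Set E) (hT : 𝒢.IsSpanningTree T)
    (hfg : ∀ u, Group.FG (𝒢.vertexGroup u))
    (hfin : ∀ e, Finite (𝒢.edgeGroup e))
    (hres : ∀ u, Group.ResiduallyFinite (𝒢.vertexGroup u) ∨
      IsVirtuallyTorsionFree (𝒢.vertexGroup u)) :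
    bettiVolume (𝒢.FundamentalGroup T) =
      (∑ u, bettiVolume (𝒢.vertexGroup u)) + ∑ e, 1 / (Nat.card (𝒢.edgeGroup e) : ℝ) := by
  have hV : (0 : ℝ) < Fintype.card V := by
    rw [← hT.ncard_add_one]
    positivity
  refine bettiVolume_eq_of_forall _ (fun ε hε => ?_) fun ε hε H => ?_
  -- Upper bound: the error `ε` is shared equally among the vertices.
  · choose H hH using fun u => exists_forall_bettiRatio_le (G := 𝒢.vertexGroup u) (div_pos hε hV)
    obtain ⟨N, hN, hNf, hNu, hNe⟩ := hT.exists_normal hres H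
    refine ⟨⟨N, hNf⟩, fun K hK => ?_⟩
    have hconj : ∀ g h, g⁻¹ * h * g ∈ K.1 → h ∈ N := by
      intro g h hg
      have := hN.conj_mem _ (hK hg) g
      rwa [show g * (g⁻¹ * h * g) * g⁻¹ = h by group] at this
    refine (hT.bettiRatio_le K (fun e a g h => hNe e a (hconj g _ h))
      (fun u => bettiVolume (𝒢.vertexGroup u) + ε / Fintype.card V) fun u g L hL =>
        hH u L fun a ha => hNu u a (hconj g _ ((hL a).1 ha))).trans (le_of_eq ?_)
    rw [Finset.sum_add_distrib, Finset.sum_const, Finset.card_univ, nsmul_eq_mul,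
      mul_div_cancel₀ _ hV.ne']
    ring
  -- Lower bound: only freeness of the edge groups is needed from `N`, hence the trivial choice `⊤`
  -- at the vertices.
  · obtain ⟨N, hN, hNf, -, hNe⟩ := hT.exists_normal hres fun u => ⟨⊤, inferInstance⟩
    have := H.2
    let M := N ⊓ H.1.normalCore
    have hM : M.Normal := inferInstanceAs (N ⊓ H.1.normalCore).Normal
    have hMf : M.FiniteIndex := inferInstanceAs (N ⊓ H.1.normalCore).FiniteIndex
    have hconj : ∀ g h, g⁻¹ * h * g ∈ M ↔ h ∈ M := by
      intro g h
      rw [hM.mem_comm_iff, mul_inv_cancel_left]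
    choose K hKM hK using fun u => exists_le_bettiRatio (G := 𝒢.vertexGroup u) (div_pos hε hV)
      ⟨M.comap (𝒢.of T u), ⟨by
        rw [Subgroup.index_comap]
        exact mt Subgroup.index_eq_zero_of_relIndex_eq_zero hMf.index_ne_zero⟩⟩
    have hKM' : ∀ u (a g : 𝒢.vertexGroup u), g⁻¹ * a * g ∈ (K u).1 → 𝒢.of T u a ∈ M := by
      intro u a g h
      have h1 : 𝒢.of T u (g⁻¹ * a * g) ∈ M := hKM u h
      rwa [map_mul, map_mul, map_inv, hconj] at h1
    obtain ⟨n, ρ, hn, hρ⟩ := hT.exists_rep K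
      (fun e a g h => hNe e a (hKM' _ _ _ h).1)
      (fun e a g h => by
        -- The stable letter conjugates the image at the terminal vertex to the one at the initial
        -- vertex, where `hNe` applies.
        have h1 := hM.conj_mem _ (hKM' _ _ _ h) (𝒢.stableLetter T e)
        rw [GraphOfGroups.stableLetter_mul, mul_inv_cancel_right] at h1
        exact hNe e a h1.1)
    have hSf := (actionCocycles.stab ρ ⟨0, hn⟩).2
    -- Intersecting with `M` puts the subgroup below `H` without changing its traces on the vertex
    -- groups, since the conjugates of `K u` already map into `M`.
    let L₀ : FinIndexSubgroup (𝒢.FundamentalGroup T) :=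
      ⟨(actionCocycles.stab ρ ⟨0, hn⟩).1 ⊓ M, inferInstance⟩
    refine ⟨L₀, fun g hg => H.1.normalCore_le hg.2.2, ?_⟩
    rw [hT.bettiRatio_eq L₀ (fun e a g h => hNe e a ((hconj g _).1 h.2).1)
      (fun u => bettiRatio _ (K u))]
    · have : ∑ u, (bettiVolume (𝒢.vertexGroup u) - ε / Fintype.card V) ≤
          ∑ u, bettiRatio _ (K u) := Finset.sum_le_sum fun u _ => hK u
      rw [Finset.sum_sub_distrib, Finset.sum_const, Finset.card_univ, nsmul_eq_mul,
        mul_div_cancel₀ _ hV.ne'] at this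
      linarith
    · intro u g L hL
      -- The conjugate by `g` of the stabilizer of the base point is the stabilizer of its image
      -- under `ρ g`, whose trace on the vertex group is a conjugate of `K u`.
      obtain ⟨b, hb⟩ := hρ u (ρ g ⟨0, hn⟩)
      refine bettiRatio_conj _ _ b fun a => ?_
      rw [hL, ← hb, Subgroup.mem_inf, hconj, actionCocycles.mem_stab, map_mul, map_mul,
        map_inv, Equiv.Perm.mul_apply, Equiv.Perm.mul_apply, Equiv.Perm.inv_eq_iff_eq]
      exact and_iff_left_of_imp fun h => hKM' u a b ((hb a).1 h)
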